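/- **Setting.** A public-key single-decryptor encryption (SDE) scheme with (non-empty, finite) plaintext space $\mathcal M=\mathcal M_\lambda$ is a tuple of QPT algorithms $\mathsf{Setup}(1^\lambda)\to(\mathsf{pk},\mathsf{msk})$, $\mathsf{KG}(\mathsf{msk})\to\mathsf{sk}$ (a quantum state), $\mathsf{Enc}(\mathsf{pk},m)\to\mathsf{ct}$ and $\mathsf{Dec}(\mathsf{sk},\mathsf{ct})\to m'\in\mathcal M\cup\{\bot\}$; $\mathsf{pk},\mathsf{msk},\mathsf{ct}$ are classical, and there is a negligible function $\nu$ such that for every $\lambda$ and every $m\in\mathcal M$ an honestly generated encryption of $m$ is decrypted to $m$ by an honestly generated key with probability at least $1-\nu(\lambda)$. A quantum decryptor is a pair $(\delta,U)$ of a state and a unitary circuit; it is run on a ciphertext $\mathsf{ct}$ by applying $U$ to $|\mathsf{ct}\rangle\otimes\delta$ and measuring the output wires. For a public key $\mathsf{pk}$ and a circuit $U$ let $P_{\mathsf{pk},U}$ be the operator on the decryptor's register such that $\operatorname{Tr}[P_{\mathsf{pk},U}\,\delta]$ is the probability that $(\delta,U)$ outputs $m$ on $\mathsf{ct}\leftarrow\mathsf{Enc}(\mathsf{pk},m)$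 for uniform $m\leftarrow\mathcal M$. The test for a $\gamma$-good search-type decryptor is the threshold implementation of $(P_{\mathsf{pk},U},I-P_{\mathsf{pk},U})$ with threshold $1/|\mathcal M|+\gamma$: measure the eigenvalue $p$ of $P_{\mathsf{pk},U}$ and pass if and only if $p\ge 1/|\mathcal M|+\gamma$. In both games below, the challenger runs $(\mathsf{pk},\mathsf{msk})\leftarrow\mathsf{Setup}(1^\lambda)$ and sends $(1^\lambda,\mathsf{pk})$ to the adversary $\mathcal A$; $\mathcal A$ replies with $1^q$ for a $q$ of its choice; the challenger sends independently generated keys $\mathsf{sk}_1,\dots,\mathsf{sk}_q\leftarrow\mathsf{KG}(\mathsf{msk})$; and $\mathcal A$ outputs $q+1$ possibly entangled quantum decryptors, i.e. a state $\delta$ on registers $R_1,\dots,R_{q+1}$ and unitary circuits $U_1,\dots,U_{q+1}$. * *Strong-search game with parameter $\gamma$.* The challenger applies the test for a $\gamma$-good search-type decryptor to each $R_i$ (with circuit $U_i$); $\mathcal A$ wins if all $q+1$ tests pass. The scheme is collusion-resistant strong-search anti-piracy secure if for every inverse polynomial $\gamma=\gamma(\lambda)\in(0,1]$ every QPT adversary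 wins with negligible probability. * *Identical-challenge game.* The challenger samples one uniform $m\leftarrow\mathcal M$ and one $\mathsf{ct}\leftarrow\mathsf{Enc}(\mathsf{pk},m)$, and runs all $q+1$ decryptors on this same $\mathsf{ct}$; $\mathcal A$ wins if all of them output $m$. The scheme is collusion-resistant identical-challenge search anti-piracy secure if for every inverse polynomial $\gamma$ and every QPT adversary there is a negligible function $\nu$ such that the adversary wins with probability at most $1/|\mathcal M|+\gamma(\lambda)+\nu(\lambda)$ for all $\lambda$. **Theorem 8.5.** Let an SDE scheme be collusion-resistant strong-search anti-piracy secure, and let $1/|\mathcal M_\lambda|$ be negligible in $\lambda$. Then the scheme is collusion-resistant identical-challenge search anti-piracy secure. -/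

import Mathlib

open scoped Matrix Kronecker

noncomputable section

namespace QCrypt

/-! ### Negligible functions and inverse polynomials -/

/-- `f` is negligible: `n ^ k * f n → 0` for every `k`. -/
def Negligible (f : ℕ → ℝ) : Prop :=
  Asymptotics.SuperpolynomialDecay Filter.atTop (fun n : ℕ => (n : ℝ)) f

/-- `γ : ℕ → (0, 1]` is (at least) one over a polynomial. -/
def InversePolynomial (γ : ℕ → ℝ) : Prop :=
  (∀ n, 0 < γ n ∧ γ n ≤ 1) ∧
    ∃ p : Polynomial ℕ, ∀ n, 0 < p.eval n ∧ 1 / ((p.eval n : ℕ) : ℝ) ≤ γ n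

/-! ### Gates, binary codes and classical polynomial time -/

/-- Elementary gates (a universal set), acting on wires numbered by natural numbers. -/
inductive Gate
  | H (i : ℕ)
  | T (i : ℕ)
  | CNOT (i j : ℕ)

/-- A self-delimiting binary code. -/
class Code (α : Type) where
  code : α → List Bool
  inj : ∀ {a b : α} {s t : List Bool}, code a ++ s = code b ++ t → a = b ∧ s = t

/-- Natural numbers are written in unary. -/
def codeNat : ℕ → List Bool
  | 0 => [false]
  | n + 1 => true :: codeNat n

theorem codeNat_inj : ∀ {a b : ℕ} {s t : List Bool},
    codeNat a ++ s = codeNat b ++ t → a = b ∧ s = t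
  | 0, 0, _, _, h => by simpa [codeNat] using h
  | 0, _ + 1, _, _, h => by simp [codeNat] at h
  | _ + 1, 0, _, _, h => by simp [codeNat] at h
  | a + 1, b + 1, s, t, h => by
    have := codeNat_inj (a := a) (b := b) (s := s) (t := t) (by simpa [codeNat] using h)
    simpa using this

instance : Code ℕ := ⟨codeNat, codeNat_inj⟩

instance : Code Bool := ⟨fun b => [b], fun h => by simpa using h⟩

instance {α β : Type} [Code α] [Code β] : Code (α × β) where
  code x := Code.code x.1 ++ Code.code x.2
  inj {a b s t} h := by
    rw [List.append_assoc, List.append_assoc] at h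
    obtain ⟨h₁, h₂⟩ := Code.inj h
    obtain ⟨h₃, h₄⟩ := Code.inj h₂
    exact ⟨Prod.ext h₁ h₃, h₄⟩

def codeList {α : Type} [Code α] : List α → List Bool
  | [] => [false]
  | a :: l => true :: (Code.code a ++ codeList l)

theorem codeList_inj {α : Type} [Code α] : ∀ {a b : List α} {s t : List Bool},
    codeList a ++ s = codeList b ++ t → a = b ∧ s = t
  | [], [], _, _, h => by simpa [codeList] using h
  | [], _ :: _, _, _, h => by simp [codeList] at h
  | _ :: _, [], _, _, h => by simp [codeList] at h
  | a :: l, b :: l', s, t, h => by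
    simp only [codeList, List.cons_append, List.append_assoc, List.cons.injEq, true_and] at h
    obtain ⟨h₁, h₂⟩ := Code.inj h
    obtain ⟨h₃, h₄⟩ := codeList_inj h₂
    exact ⟨by rw [h₁, h₃], h₄⟩

instance {α : Type} [Code α] : Code (List α) := ⟨codeList, codeList_inj⟩

def codeGate : Gate → List Bool
  | .H i => false :: false :: codeNat i
  | .T i => false :: true :: codeNat i
  | .CNOT i j => true :: (codeNat i ++ codeNat j)

theorem codeGate_inj {a b : Gate} {s t : List Bool} (h : codeGate a ++ s = codeGate b ++ t) :
    a = b ∧ s = t := by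
  cases a <;> cases b <;>
    simp only [codeGate, List.cons_append, List.append_assoc, List.cons.injEq, true_and,
      Bool.false_eq_true, Bool.true_eq_false, false_and] at h
  · obtain ⟨h₁, h₂⟩ := codeNat_inj h
    exact ⟨by rw [h₁], h₂⟩
  · obtain ⟨h₁, h₂⟩ := codeNat_inj h
    exact ⟨by rw [h₁], h₂⟩
  · obtain ⟨h₁, h₂⟩ := codeNat_inj h
    obtain ⟨h₃, h₄⟩ := codeNat_inj h₂
    exact ⟨by rw [h₁, h₃], h₄⟩

instance : Code Gate := ⟨codeGate, codeGate_inj⟩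

/-- `f` is computed by a deterministic Turing machine in time polynomial in the length of the
code of its argument. -/
def PolyTime {α β : Type} [Code α] [Code β] (f : α → β) : Prop :=
  Nonempty (Turing.TM2ComputableInPolyTime (Code.code (α := α)) (Code.code (α := β)) f)

/-! ### Qubits and circuits -/

/-- Bit strings of length `n`, which index the computational basis of `n` qubits. -/
abbrev Bits (n : ℕ) : Type := Fin n → Bool

/-- Operators on the space with orthonormal basis `ι`. -/
abbrev Op (ι : Type) : Type := Matrix ι ι ℂ

/-- The unitary of a gate on `n` wires. A gate that refers to a missing wire, or a `CNOT` whose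
control is its target, does nothing. -/
def Gate.mat (n : ℕ) : Gate → Op (Bits n)
  | .H i => if h : i < n then
      Matrix.of fun x y =>
        if ∀ k, k ≠ ⟨i, h⟩ → x k = y k then
          (if x ⟨i, h⟩ && y ⟨i, h⟩ then -1 else 1) / (Real.sqrt 2 : ℂ)
        else 0
      else 1
  | .T i => if h : i < n then
      Matrix.diagonal fun x => if x ⟨i, h⟩ then Complex.exp (Complex.I * Real.pi / 4) else 1
      else 1
  | .CNOT i j => if h : i < n ∧ j < n ∧ i ≠ j then
      Matrix.of fun x y =>
        if x = Function.update y ⟨j, h.2.1⟩ (xor (y ⟨j, h.2.1⟩) (y ⟨i, h.1⟩)) then 1 else 0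
      else 1

/-- The unitary of a circuit on `n` wires; the head of the list is applied first. -/
def circMat (n : ℕ) (gs : List Gate) : Op (Bits n) :=
  gs.foldl (fun U g => g.mat n * U) 1

/-- The state `|0…0⟩⟨0…0|`. -/
def zeroState (n : ℕ) : Op (Bits n) := Matrix.single (fun _ => false) (fun _ => false) 1

/-- `ρ ⊗ σ`, with the wires of `ρ` first. -/
def tensor {m n : ℕ} (ρ : Op (Bits m)) (σ : Op (Bits n)) : Op (Bits (m + n)) :=
  (ρ ⊗ₖ σ).reindex (Fin.appendEquiv m n) (Fin.appendEquiv m n)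

/-- `σ ⊗ ⋯ ⊗ σ` (`q` factors). -/
def tensorPow {k : ℕ} (σ : Op (Bits k)) : (q : ℕ) → Op (Bits (k * q))
  | 0 => zeroState (k * 0)
  | q + 1 => tensor (tensorPow σ q) σ

/-- Discard the last `n` wires. -/
def ptraceRight {m n : ℕ} (ρ : Op (Bits (m + n))) : Op (Bits m) :=
  ∑ z : Bits n, ρ.submatrix (fun x => Fin.append x z) (fun x => Fin.append x z)

/-- Measure the first `m` wires in the computational basis: the unnormalised state of the other
wires for outcome `y`. Its trace is the probability of `y`. -/
def postMeasure {m n : ℕ} (y : Bits m) (ρ : Op (Bits (m + n))) : Op (Bits n) :=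
  ρ.submatrix (fun x => Fin.append y x) (fun x => Fin.append y x)

/-- The product operator `A 0 ⊗ A 1 ⊗ ⋯` on a finite family of registers. -/
def tensorFamily {q : ℕ} {B : Fin q → Type} (A : ∀ i, Op (B i)) : Op (∀ i, B i) :=
  Matrix.of fun x y => ∏ i, A i (x i) (y i)

/-- Split a row of `∑ i, size i` wires into consecutive registers of `size i` wires. -/
def splitRegs {q : ℕ} (size : Fin q → ℕ) :
    Bits (∑ i, size i) ≃ (∀ i, Bits (size i)) :=
  (Equiv.arrowCongr finSigmaFinEquiv.symm (Equiv.refl Bool)).trans (Equiv.piCurry fun _ _ => Bool)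

/-- The first `k` bits of `x`, padded by `0` if `x` is shorter. -/
def readBits {n : ℕ} (k : ℕ) (x : Bits n) : Bits k :=
  fun i => if h : (i : ℕ) < n then x ⟨i, h⟩ else false

/-! ### Quantum polynomial-time algorithms -/

/-- A (uniform) QPT algorithm with classical inputs from `α`, and possibly a quantum input: a
polynomial-time Turing machine computes from the classical input a number of ancillas and a
circuit. Intermediate measurements are deferred. -/
structure QAlg (α : Type) [Code α] where
  anc : α → ℕ
  circ : α → List Gate
  anc_poly : PolyTime anc
  circ_poly : PolyTime circ

/-- The `k` output qubits of a QPT algorithm on classical input `a` and quantum input `ρ`: the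
circuit acts on the output register and the ancillas, initialised to `|0⟩`, and on the input
register; all but the output register is then discarded. -/
def QAlg.run {α : Type} [Code α] (A : QAlg α) (a : α) (k : ℕ) {j : ℕ} (ρ : Op (Bits j)) :
    Op (Bits k) :=
  let U := circMat (k + (j + A.anc a)) (A.circ a)
  ptraceRight (U * tensor (zeroState k) (tensor ρ (zeroState (A.anc a))) * Uᴴ)

/-- The probability of the classical output `x`, when there is no quantum input. -/
def QAlg.prob {α : Type} [Code α] (A : QAlg α) (a : α) {k : ℕ} (x : Bits k) : ℝ :=
  (A.run a k (zeroState 0) x x).re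

/-! ### Single-decryptor encryption -/

/-- The algorithms of a public-key SDE scheme. The argument `n` is the security parameter; the
lengths of keys (for decryption keys: in qubits), ciphertexts and plaintexts depend on `n` only. -/
structure SDEAlgorithms where
  pkLen : ℕ → ℕ
  mskLen : ℕ → ℕ
  skLen : ℕ → ℕ
  ctLen : ℕ → ℕ
  msgLen : ℕ → ℕ
  pkLen_poly : PolyTime pkLen
  mskLen_poly : PolyTime mskLen
  skLen_poly : PolyTime skLen
  ctLen_poly : PolyTime ctLen
  msgLen_poly : PolyTime msgLen
  /-- the plaintext space `𝓜` -/
  msgSpace : ∀ n, Finset (Bits (msgLen n))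
  msgSpace_nonempty : ∀ n, (msgSpace n).Nonempty
  /-- `Setup(1ⁿ)` -/
  setup : QAlg ℕ
  /-- `KG(msk)` -/
  keyGen : QAlg (ℕ × List Bool)
  /-- `Enc(pk, m)` -/
  enc : QAlg (ℕ × List Bool × List Bool)
  /-- `Dec(sk, ct)`, with quantum input `sk` -/
  dec : QAlg (ℕ × List Bool)

namespace SDEAlgorithms

variable (S : SDEAlgorithms) (n : ℕ)

/-- `Pr[Setup(1ⁿ) = (pk, msk)]`. -/
def setupProb (pk : Bits (S.pkLen n)) (msk : Bits (S.mskLen n)) : ℝ :=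
  S.setup.prob n (Fin.append pk msk)

/-- The quantum decryption key output by `KG(msk)`. -/
def keyState (msk : Bits (S.mskLen n)) : Op (Bits (S.skLen n)) :=
  S.keyGen.run (n, List.ofFn msk) (S.skLen n) (zeroState 0)

/-- `Pr[Enc(pk, m) = ct]`. -/
def encProb (pk : Bits (S.pkLen n)) (m : Bits (S.msgLen n)) (ct : Bits (S.ctLen n)) : ℝ :=
  S.enc.prob (n, List.ofFn pk, List.ofFn m) ct

/-- `Pr[Dec(sk, ct) = m]`. The first output bit is `0` for the output `⊥`, and `1` for a
plaintext, which follows it. -/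
def decProb (sk : Op (Bits (S.skLen n))) (ct : Bits (S.ctLen n)) (m : Bits (S.msgLen n)) : ℝ :=
  let x : Bits (1 + S.msgLen n) := Fin.append (fun _ => true) m
  (S.dec.run (n, List.ofFn ct) (1 + S.msgLen n) sk x x).re

/-- The probability that an honestly encrypted `m` is correctly decrypted. -/
def correctProb (m : Bits (S.msgLen n)) : ℝ :=
  ∑ pk, ∑ msk, S.setupProb n pk msk *
    ∑ ct, S.encProb n pk m ct * S.decProb n (S.keyState n msk) ct m

end SDEAlgorithms

/-- A public-key single-decryptor encryption scheme: algorithms with decryption correctness. -/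
structure SDEScheme extends SDEAlgorithms where
  correct : ∃ ν : ℕ → ℝ, Negligible ν ∧
    ∀ n, ∀ m ∈ msgSpace n, 1 - ν n ≤ toSDEAlgorithms.correctProb n m

/-! ### Quantum decryptors -/

/-- `num` possibly entangled quantum decryptors. The `i`-th consists of the `i`-th register of
the common state and of a unitary circuit on that register and a ciphertext. -/
structure Decryptors where
  num : ℕ
  size : Fin num → ℕ
  circ : Fin num → List Gate
  state : Op (∀ i, Bits (size i))

/-- The POVM element, on a decryptor's register of `s` qubits, for the output `m` on input `ct`:
run the circuit on `|ct⟩` and the register, and measure the first wires. -/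
def decEffect (s : ℕ) (gs : List Gate) {c k : ℕ} (ct : Bits c) (m : Bits k) : Op (Bits s) :=
  let V : Matrix (Bits (c + s)) (Bits s) ℂ :=
    (circMat (c + s) gs).submatrix id (fun x => Fin.append ct x)
  Vᴴ * Matrix.diagonal (fun z : Bits (c + s) => if readBits k z = m then (1 : ℂ) else 0) * V

/-- The projection onto outcome `1` of the threshold implementation, with threshold `t`, of the
binary POVM `(P, 1 - P)`. The projective implementation of the POVM measures the eigenvalue `p`
of `P`, and the outcome is `1` when `t ≤ p`: this is the spectral projection `𝟙_[t,∞)(P)`. -/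
def thresholdImpl {ι : Type} [Fintype ι] [DecidableEq ι] (t : ℝ) (P : Op ι) : Op ι :=
  cfc (fun p : ℝ => if t ≤ p then (1 : ℝ) else 0) P

namespace SDEAlgorithms

variable (S : SDEAlgorithms) (n : ℕ) (pk : Bits (S.pkLen n))

/-- The average of `f m ct` over uniform `m ← 𝓜` and `ct ← Enc(pk, m)`. -/
def challengeAvg {V : Type} [AddCommGroup V] [Module ℝ V]
    (f : Bits (S.msgLen n) → Bits (S.ctLen n) → V) : V :=
  (1 / ((S.msgSpace n).card : ℝ)) •
    ∑ m ∈ S.msgSpace n, ∑ ct, S.encProb n pk m ct • f m ct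

/-- The POVM element for a decryptor to recover a random encrypted plaintext. -/
def searchPOVM (s : ℕ) (gs : List Gate) : Op (Bits s) :=
  S.challengeAvg n pk fun m ct => decEffect s gs ct m

/-- The probability that all decryptors pass the test for a `γ`-good search-type decryptor. -/
def strongSearchWin (γ : ℝ) (D : Decryptors) : ℝ :=
  (tensorFamily (fun i => thresholdImpl (1 / ((S.msgSpace n).card : ℝ) + γ)
    (S.searchPOVM n pk (D.size i) (D.circ i))) * D.state).trace.re

/-- The probability that all decryptors output the plaintext of one common random challenge. -/
def identicalChallengeWin (D : Decryptors) : ℝ :=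
  S.challengeAvg n pk fun m ct =>
    (tensorFamily (fun i => decEffect (D.size i) (D.circ i) ct m) * D.state).trace.re

end SDEAlgorithms

/-! ### Adversaries and experiments -/

/-- A QPT adversary of an anti-piracy game.

First stage: on `(1ⁿ, pk)` it produces a classical string `y` (of `out₁` bits) and a quantum
memory (of `mem` qubits), and asks for `numKeys` decryption keys. Second stage: from the memory
and the keys it produces a classical string `z` (of `out₂` bits) and a state on `numKeys + 1`
registers, whose sizes are listed in `regs`; the circuits of the decryptors are listed in
`circuits`. Entries missing in a list are read as `0`, or as the empty circuit. -/
structure QPTAdversary where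
  out₁ : ℕ × List Bool → ℕ
  mem : ℕ × List Bool → ℕ
  stage₁ : QAlg (ℕ × List Bool)
  numKeys : ℕ × List Bool × List Bool → ℕ
  out₂ : ℕ × List Bool × List Bool → ℕ
  regs : ℕ × List Bool × List Bool → List ℕ
  stage₂ : QAlg (ℕ × List Bool × List Bool)
  circuits : ℕ × List Bool × List Bool × List Bool → List (List Gate)
  out₁_poly : PolyTime out₁
  mem_poly : PolyTime mem
  numKeys_poly : PolyTime numKeys
  out₂_poly : PolyTime out₂
  regs_poly : PolyTime regs
  circuits_poly : PolyTime circuits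

namespace QPTAdversary

variable (A : QPTAdversary)

/-- The unnormalised quantum memory after a first stage with classical result `y`. -/
def memory (a : ℕ × List Bool) (y : Bits (A.out₁ a)) : Op (Bits (A.mem a)) :=
  postMeasure y (A.stage₁.run a (A.out₁ a + A.mem a) (zeroState 0))

/-- The size of the `i`-th decryptor's register. -/
def regSize (b : ℕ × List Bool × List Bool) (i : Fin (A.numKeys b + 1)) : ℕ :=
  (A.regs b).getD i 0

/-- The unnormalised state of the decryptors' registers after a second stage with classical result
`z`, from the memory `μ` and independent keys `κ`. -/
def registers (b : ℕ × List Bool × List Bool) {j k : ℕ} (μ : Op (Bits j)) (κ : Op (Bits k))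
    (z : Bits (A.out₂ b)) : Op (∀ i, Bits (A.regSize b i)) :=
  (postMeasure z (A.stage₂.run b (A.out₂ b + ∑ i, A.regSize b i)
    (tensor μ (tensorPow κ (A.numKeys b))))).reindex
      (splitRegs (A.regSize b)) (splitRegs (A.regSize b))

/-- The decryptors output by the adversary; the trace of the state is the probability of the
classical results `y` and `z`, given `pk` and `msk`. -/
def output (S : SDEAlgorithms) (n : ℕ) (pk : Bits (S.pkLen n)) (msk : Bits (S.mskLen n))
    (y : Bits (A.out₁ (n, List.ofFn pk)))
    (z : Bits (A.out₂ (n, List.ofFn pk, List.ofFn y))) : Decryptors :=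
  let b := (n, List.ofFn pk, List.ofFn y)
  { num := A.numKeys b + 1
    size := A.regSize b
    circ := fun i => (A.circuits (n, List.ofFn pk, List.ofFn y, List.ofFn z)).getD i []
    state := A.registers b (A.memory (n, List.ofFn pk) y) (S.keyState n msk) z }

/-- The probability that the adversary wins the game in which the challenger's final test of the
decryptors (given the public key) succeeds with probability `win`. -/
def advantage (S : SDEAlgorithms) (n : ℕ) (win : Bits (S.pkLen n) → Decryptors → ℝ) : ℝ :=
  ∑ pk, ∑ msk, S.setupProb n pk msk * ∑ y, ∑ z, win pk (A.output S n pk msk y z)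

end QPTAdversary

/-! ### Security notions -/

namespace SDEScheme

variable (S : SDEScheme)

/-- Strong-search `γ`-anti-piracy security. -/
def StrongSearchSecureAt (γ : ℕ → ℝ) : Prop :=
  ∀ A : QPTAdversary, Negligible fun n =>
    A.advantage S.toSDEAlgorithms n fun pk D => S.strongSearchWin n pk (γ n) D

/-- Collusion-resistant strong-search anti-piracy security. -/
def StrongSearchSecure : Prop :=
  ∀ γ, InversePolynomial γ → S.StrongSearchSecureAt γ

/-- Identical-challenge search `γ`-anti-piracy security. -/
def IdenticalChallengeSecureAt (γ : ℕ → ℝ) : Prop :=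
  ∀ A : QPTAdversary, ∃ ν : ℕ → ℝ, Negligible ν ∧ ∀ n,
    A.advantage S.toSDEAlgorithms n (fun pk D => S.identicalChallengeWin n pk D) ≤
      1 / ((S.msgSpace n).card : ℝ) + γ n + ν n

/-- Collusion-resistant identical-challenge search anti-piracy security. -/
def IdenticalChallengeSecure : Prop :=
  ∀ γ, InversePolynomial γ → S.IdenticalChallengeSecureAt γ

end SDEScheme

end QCrypt

end

noncomputable section

namespace QCrypt

open scoped MatrixOrder ComplexOrder

/-! The same adversary serves in both games; only the operators measured on its output are compared.
Let `E` be the average, over the common challenge, of the product of the decryptors' effects, so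
that identical-challenge success is the trace of `E` against the state. Every effect lies between 0
and 1, so dropping all factors but the `k`-th before averaging gives `E ≤ P k` on register `k`,
where `P k` is the search POVM element.

Let `Θ k` be the threshold projection of `P k` at `t = 1/|𝓜| + γ'`. Since `E` need not commute with
these projections, the identity is split according to the first register whose test fails, plus the
branch where all tests pass. Cauchy–Schwarz removes the cross terms at the cost of a factor `q + 1`,
the number of branches. A failing branch contributes at most `t`, because `P k` is at most `t` on
the rejected subspace; the accepting branch contributes at most the product of the `Θ k`. This is
`le_thresholdImpl_of_le_marginals`.

With `N` a polynomial bound on the number of branches, identical-challenge success is at most `N`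
times strong-search success plus `N² t` (`advantage_identicalChallenge_le`). Taking `γ' = γ / N²`
leaves `γ`, plus `N` times a strong-search advantage and `N²/|𝓜|`, both negligible. The polynomial
`N` exists because a polynomial-time machine can only write a polynomially long unary number
(`numKeys_le`). -/

theorem exists_eq_conjTranspose_mul_self {ι : Type} [Fintype ι] {A : Op ι} (hA : 0 ≤ A) :
    ∃ C : Op ι, A = Cᴴ * C := by
  classical
  exact CStarAlgebra.nonneg_iff_eq_star_mul_self.1 hA

/-! ### Product operators and the Loewner order -/

section TensorFamily

variable {q : ℕ} {B : Fin q → Type}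

theorem tensorFamily_mul [∀ i, Fintype (B i)] (A A' : ∀ i, Op (B i)) :
    tensorFamily A * tensorFamily A' = tensorFamily fun i => A i * A' i := by
  ext x y
  simp only [tensorFamily, Matrix.mul_apply, Matrix.of_apply, ← Finset.prod_mul_distrib]
  rw [Fintype.prod_sum]

theorem tensorFamily_one [∀ i, DecidableEq (B i)] :
    tensorFamily (fun i => (1 : Op (B i))) = 1 := by
  ext x y
  by_cases h : x = y
  · subst h; simp [tensorFamily]
  · obtain ⟨i, hi⟩ := Function.ne_iff.1 h
    rw [Matrix.one_apply_ne h]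
    exact Finset.prod_eq_zero (Finset.mem_univ i) (Matrix.one_apply_ne hi)

theorem tensorFamily_conjTranspose (A : ∀ i, Op (B i)) :
    (tensorFamily A)ᴴ = tensorFamily fun i => (A i)ᴴ := by
  ext x y
  simp [tensorFamily, Matrix.conjTranspose_apply]

theorem tensorFamily_update_apply (A : ∀ i, Op (B i)) (k : Fin q) (M : Op (B k))
    (x y : ∀ i, B i) :
    tensorFamily (Function.update A k M) x y =
      M (x k) (y k) * ∏ i ∈ Finset.univ.erase k, A i (x i) (y i) := by
  rw [tensorFamily, Matrix.of_apply, ← Finset.mul_prod_erase _ _ (Finset.mem_univ k)]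
  congr 1
  · simp
  · refine Finset.prod_congr rfl fun i hi => ?_
    rw [Function.update_of_ne (Finset.ne_of_mem_erase hi)]

theorem tensorFamily_update_sub (A : ∀ i, Op (B i)) (k : Fin q) (M N : Op (B k)) :
    tensorFamily (Function.update A k (M - N)) =
      tensorFamily (Function.update A k M) - tensorFamily (Function.update A k N) := by
  ext x y
  simp only [tensorFamily_update_apply, Matrix.sub_apply, sub_mul]

/-- Placing an operator in the `k`-th factor is linear. -/
def tensorUpdate (A : ∀ i, Op (B i)) (k : Fin q) : Op (B k) →ₗ[ℝ] Op (∀ i, B i) where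
  toFun M := tensorFamily (Function.update A k M)
  map_add' M N := by
    ext x y
    simp only [tensorFamily_update_apply, Matrix.add_apply, add_mul]
  map_smul' c M := by
    ext x y
    simp only [tensorFamily_update_apply, Matrix.smul_apply, smul_mul_assoc, RingHom.id_apply]

theorem tensorUpdate_apply (A : ∀ i, Op (B i)) (k : Fin q) (M : Op (B k)) :
    tensorUpdate A k M = tensorFamily (Function.update A k M) := rfl

variable [∀ i, Fintype (B i)]

theorem tensorFamily_nonneg {A : ∀ i, Op (B i)} (hA : ∀ i, 0 ≤ A i) : 0 ≤ tensorFamily A := by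
  choose C hC using fun i => exists_eq_conjTranspose_mul_self (hA i)
  have : tensorFamily A = (tensorFamily C)ᴴ * tensorFamily C := by
    rw [tensorFamily_conjTranspose, tensorFamily_mul]
    exact congrArg tensorFamily (funext hC)
  rw [this]
  exact Matrix.nonneg_iff_posSemidef.2 (Matrix.posSemidef_conjTranspose_mul_self _)

/-- Hybrid argument: factors are exchanged one at a time, and two consecutive hybrids differ by a
product operator with `A' k - A k` in one slot and positive factors elsewhere. -/
theorem tensorFamily_mono {A A' : ∀ i, Op (B i)} (hA : ∀ i, 0 ≤ A i) (h : ∀ i, A i ≤ A' i) :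
    tensorFamily A ≤ tensorFamily A' := by
  have key : ∀ s : Finset (Fin q), tensorFamily A ≤ tensorFamily (s.piecewise A' A) := by
    intro s
    induction s using Finset.induction_on with
    | empty => simp
    | insert k s hk ih =>
      refine ih.trans ?_
      rw [Finset.piecewise_insert]
      have h₀ : s.piecewise A' A = Function.update (s.piecewise A' A) k (A k) := by
        conv_lhs => rw [← Function.update_eq_self k (s.piecewise A' A)]
        rw [Finset.piecewise_eq_of_notMem _ _ _ hk]
      rw [← sub_nonneg]
      conv_rhs => rw [h₀, Function.update_idem, ← tensorFamily_update_sub]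
      refine tensorFamily_nonneg fun i => ?_
      rcases eq_or_ne i k with rfl | hi
      · simpa using h i
      · rw [Function.update_of_ne hi]
        by_cases his : i ∈ s
        · simpa [his] using (hA i).trans (h i)
        · simpa [his] using hA i
  simpa using key Finset.univ

variable [∀ i, DecidableEq (B i)]

/-- Success of all decryptors implies success of the `k`-th. Averaged over the challenge, this
yields the marginal bounds on `E`. -/
theorem tensorFamily_le_update_one {A : ∀ i, Op (B i)} (hA : ∀ i, 0 ≤ A i) (h : ∀ i, A i ≤ 1)
    (k : Fin q) :
    tensorFamily A ≤ tensorFamily (Function.update (fun i => (1 : Op (B i))) k (A k)) := by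
  refine tensorFamily_mono hA fun i => ?_
  rcases eq_or_ne i k with rfl | hi
  · simp
  · rw [Function.update_of_ne hi]; exact h i

theorem tensorFamily_le_one {A : ∀ i, Op (B i)} (hA : ∀ i, 0 ≤ A i) (h : ∀ i, A i ≤ 1) :
    tensorFamily A ≤ 1 := by
  rw [← tensorFamily_one]
  exact tensorFamily_mono hA h

end TensorFamily

/-! ### Traces, Cauchy–Schwarz and threshold projections -/

section Order

variable {ι : Type} [Fintype ι]

theorem conj_le_conj {A B : Op ι} (h : A ≤ B) {κ : Type} [Fintype κ] (C : Matrix ι κ ℂ) :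
    Cᴴ * A * C ≤ Cᴴ * B * C := by
  rw [Matrix.le_iff] at h ⊢
  have := h.conjTranspose_mul_mul_same C
  rwa [Matrix.mul_sub, Matrix.sub_mul] at this

theorem trace_re_nonneg {A : Op ι} (hA : 0 ≤ A) : 0 ≤ A.trace.re :=
  (Complex.le_def.1 (Matrix.nonneg_iff_posSemidef.1 hA).trace_nonneg).1

theorem trace_mul_nonneg {A ρ : Op ι} (hA : 0 ≤ A) (hρ : 0 ≤ ρ) : 0 ≤ (A * ρ).trace.re := by
  obtain ⟨C, rfl⟩ := exists_eq_conjTranspose_mul_self hρ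
  rw [← Matrix.mul_assoc, Matrix.trace_mul_comm, ← Matrix.mul_assoc]
  have := conj_le_conj hA Cᴴ
  rw [Matrix.conjTranspose_conjTranspose, Matrix.mul_zero, Matrix.zero_mul] at this
  exact trace_re_nonneg this

theorem trace_mul_mono {A B ρ : Op ι} (h : A ≤ B) (hρ : 0 ≤ ρ) :
    (A * ρ).trace.re ≤ (B * ρ).trace.re := by
  have := trace_mul_nonneg (sub_nonneg.2 h) hρ
  rwa [Matrix.sub_mul, Matrix.trace_sub, Complex.sub_re, sub_nonneg] at this

theorem real_smul_nonneg {ι : Type} {A : Op ι} (hA : 0 ≤ A) {c : ℝ} (hc : 0 ≤ c) : 0 ≤ c • A := by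
  rw [Matrix.nonneg_iff_posSemidef] at hA ⊢
  exact hA.smul hc

theorem real_smul_mono {ι : Type} {A B : Op ι} (h : A ≤ B) {c : ℝ} (hc : 0 ≤ c) : c • A ≤ c • B := by
  rw [← sub_nonneg, ← smul_sub]
  exact real_smul_nonneg (sub_nonneg.2 h) hc

/-- The Cauchy–Schwarz inequality in the Loewner order. -/
theorem sum_conj_le {κ : Type} (s : Finset κ) {E : Op ι} (hE : 0 ≤ E)
    (R : κ → Op ι) :
    (∑ k ∈ s, R k)ᴴ * E * (∑ k ∈ s, R k) ≤ (s.card : ℝ) • ∑ k ∈ s, (R k)ᴴ * E * R k := by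
  -- Summing over ordered pairs makes this twice the required difference, hence the factor 1/2
  -- below.
  have key : (0 : Op ι) ≤ ∑ k ∈ s, ∑ l ∈ s, (R k - R l)ᴴ * E * (R k - R l) := by
    refine Finset.sum_nonneg fun k _ => Finset.sum_nonneg fun l _ => ?_
    simpa using conj_le_conj hE (R k - R l)
  have expand : ∑ k ∈ s, ∑ l ∈ s, (R k - R l)ᴴ * E * (R k - R l) =
      (2 : ℝ) • ((s.card : ℝ) • ∑ k ∈ s, (R k)ᴴ * E * R k -
        (∑ k ∈ s, R k)ᴴ * E * (∑ k ∈ s, R k)) := by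
    have h₁ : ∑ k ∈ s, ∑ l ∈ s, (R k)ᴴ * E * R l = (∑ k ∈ s, R k)ᴴ * E * ∑ k ∈ s, R k := by
      simp only [← Matrix.mul_sum, Matrix.conjTranspose_sum, Matrix.sum_mul]
    have h₂ : ∑ k ∈ s, ∑ l ∈ s, (R l)ᴴ * E * R k = (∑ k ∈ s, R k)ᴴ * E * ∑ k ∈ s, R k := by
      rw [Finset.sum_comm, h₁]
    simp only [Matrix.conjTranspose_sub, Matrix.sub_mul, Matrix.mul_sub, Finset.sum_sub_distrib,
      h₁, h₂, Finset.sum_const, ← Finset.smul_sum]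
    rw [← Nat.cast_smul_eq_nsmul ℝ]
    module
  rw [expand] at key
  have := real_smul_nonneg key (c := 1 / 2) (by norm_num)
  rw [smul_smul] at this
  rw [← sub_nonneg]
  simpa using this

variable [DecidableEq ι]

theorem cfc_nonneg_of_pointwise (P : Op ι) {f : ℝ → ℝ} (hf : ∀ p, 0 ≤ f p) : 0 ≤ cfc f P :=
  cfc_nonneg fun p _ => hf p

theorem thresholdImpl_nonneg (t : ℝ) (P : Op ι) : 0 ≤ thresholdImpl t P :=
  cfc_nonneg_of_pointwise P fun p => by split_ifs <;> norm_num

/-- The spectrum is finite, hence discrete, so the continuous functional calculus applies even to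
the discontinuous threshold indicator. -/
theorem continuousOn_spectrum (P : Op ι) (f : ℝ → ℝ) : ContinuousOn f (spectrum ℝ P) :=
  (Matrix.finite_real_spectrum (A := P)).continuousOn f

theorem one_sub_thresholdImpl (t : ℝ) {P : Op ι} (hP : P.IsHermitian) :
    1 - thresholdImpl t P = cfc (fun p : ℝ => if t ≤ p then (0 : ℝ) else 1) P := by
  have hP' : IsSelfAdjoint P := hP
  rw [thresholdImpl, ← cfc_const_one ℝ P, ← cfc_sub _ _ P (continuousOn_spectrum _ _)
    (continuousOn_spectrum _ _)]
  congr 1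
  funext p
  split_ifs <;> norm_num

theorem thresholdImpl_le_one (t : ℝ) {P : Op ι} (hP : P.IsHermitian) : thresholdImpl t P ≤ 1 := by
  rw [← sub_nonneg, one_sub_thresholdImpl t hP]
  exact cfc_nonneg_of_pointwise P fun p => by split_ifs <;> norm_num

theorem thresholdImpl_mul_self (t : ℝ) (P : Op ι) :
    thresholdImpl t P * thresholdImpl t P = thresholdImpl t P := by
  rw [thresholdImpl, ← cfc_mul _ _ P (continuousOn_spectrum _ _) (continuousOn_spectrum _ _)]
  congr 1
  funext p
  split_ifs <;> norm_num

theorem isHermitian_thresholdImpl (t : ℝ) (P : Op ι) : (thresholdImpl t P).IsHermitian :=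
  (Matrix.nonneg_iff_posSemidef.1 (thresholdImpl_nonneg t P)).isHermitian

/-- Outside of the accepted subspace, the POVM element is at most the threshold. -/
theorem conj_one_sub_thresholdImpl_le {t : ℝ} (ht : 0 ≤ t) {P : Op ι} (hP : P.IsHermitian) :
    (1 - thresholdImpl t P)ᴴ * P * (1 - thresholdImpl t P) ≤ t • (1 : Op ι) := by
  have hP' : IsSelfAdjoint P := hP
  have hh : (1 - thresholdImpl t P)ᴴ = 1 - thresholdImpl t P := by
    rw [Matrix.conjTranspose_sub, Matrix.conjTranspose_one, isHermitian_thresholdImpl t P]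
  have hc := fun f => continuousOn_spectrum P f
  rw [hh, one_sub_thresholdImpl t hP]
  -- With the middle `P` also written as a functional calculus, the claim is a scalar inequality:
  -- the value is `p < t` below the threshold, and `0 ≤ t` above it.
  nth_rewrite 2 [← cfc_id ℝ P]
  rw [← cfc_mul _ _ P (hc _) (hc _), ← cfc_mul _ _ P (hc _) (hc _), ← cfc_const_one ℝ P,
    ← cfc_smul t _ P (hc _)]
  refine cfc_mono (fun p _ => ?_) (hc _) (hc _)
  simp only [id, smul_eq_mul]
  split_ifs with h <;> simp <;> linarith

end Order

/-! ### Decomposition by the first failing register -/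

section Registers

variable {q : ℕ} {B : Fin q → Type} [∀ i, Fintype (B i)] [∀ i, DecidableEq (B i)]

/-- If the effect `E` on `q` registers implies, for each `i`, the effect `P i` on the `i`-th
register, then it is bounded through the threshold implementations of the `P i`. -/
theorem le_thresholdImpl_of_le_marginals {E : Op (∀ i, B i)} (hE₀ : 0 ≤ E) (hE₁ : E ≤ 1)
    {P : ∀ i, Op (B i)} (hP : ∀ i, (P i).IsHermitian) {t : ℝ} (ht : 0 ≤ t)
    (hE : ∀ k, E ≤ tensorFamily (Function.update (fun i => (1 : Op (B i))) k (P k))) :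
    E ≤ ((q : ℝ) + 1) • (tensorFamily (fun i => thresholdImpl t (P i)) +
      ((q : ℝ) * t) • (1 : Op (∀ i, B i))) := by
  set Θ : ∀ i, Op (B i) := fun i => thresholdImpl t (P i)
  -- `T j` is the event that the first `j` tests pass. `R j` is the event that test `j` is the first
  -- to fail; `R q` is the event that none fails.
  let T : ℕ → Op (∀ i, B i) := fun j => tensorFamily fun i => if (i : ℕ) < j then Θ i else 1
  let R : ℕ → Op (∀ i, B i) := fun j => if j < q then T j - T (j + 1) else T q
  have hT₀ : T 0 = 1 := by simpa [T] using tensorFamily_one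
  have hTq : T q = tensorFamily Θ := by simp [T]
  have hTH : ∀ j, (T j)ᴴ = T j := fun j => by
    simp only [T]
    rw [tensorFamily_conjTranspose]
    congr 1; funext i
    split_ifs
    · exact isHermitian_thresholdImpl _ _
    · simp
  have hTT : ∀ j, T j * T j = T j := fun j => by
    simp only [T]
    rw [tensorFamily_mul]
    congr 1; funext i
    split_ifs
    · exact thresholdImpl_mul_self _ _
    · simp
  have hT₁ : ∀ j, T j ≤ 1 := fun j => by
    refine tensorFamily_le_one (fun i => ?_) (fun i => ?_)
    · split_ifs
      · exact thresholdImpl_nonneg _ _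
      · exact zero_le_one
    · split_ifs
      · exact thresholdImpl_le_one _ (hP i)
      · exact le_rfl
  have hsum : ∑ j ∈ Finset.range (q + 1), R j = 1 := by
    rw [Finset.sum_range_succ, Finset.sum_congr rfl
      (fun j hj => if_pos (Finset.mem_range.1 hj)), Finset.sum_range_sub', hT₀]
    simp [R]
  have hRq : (R q)ᴴ * E * R q ≤ tensorFamily Θ := by
    have hR : R q = T q := if_neg (lt_irrefl q)
    rw [hR]
    refine (conj_le_conj hE₁ (T q)).trans_eq ?_
    rw [Matrix.mul_one, hTH, hTT, hTq]
  have hRj : ∀ j ∈ Finset.range q, (R j)ᴴ * E * R j ≤ t • (1 : Op (∀ i, B i)) := by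
    intro j hj
    have hj := Finset.mem_range.1 hj
    let k : Fin q := ⟨j, hj⟩
    let Q : Op (∀ i, B i) := tensorFamily (Function.update (fun i => (1 : Op (B i))) k (1 - Θ k))
    -- The factorisation lets `Q`, the failure of test `j`, act directly on `E`, where the marginal
    -- bound on register `j` applies.
    have hR : R j = Q * T j := by
      have e : Q = 1 - tensorFamily (Function.update (fun i => (1 : Op (B i))) k (Θ k)) := by
        rw [← tensorFamily_one]
        conv_rhs => rw [← Function.update_eq_self k (fun i => (1 : Op (B i)))]
        rw [Function.update_idem, ← tensorFamily_update_sub]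
      simp only [R, if_pos hj, e, Matrix.sub_mul, Matrix.one_mul]
      congr 1
      simp only [T]
      rw [tensorFamily_mul]
      congr 1; funext i
      rcases eq_or_ne i k with rfl | hi
      · simp [k]
      · have : (i : ℕ) ≠ j := fun h => hi (Fin.ext h)
        rw [Function.update_of_ne hi, Matrix.one_mul]
        exact if_congr (by omega) rfl rfl
    have hQ : Qᴴ * tensorFamily (Function.update (fun i => (1 : Op (B i))) k (P k)) * Q ≤
        t • 1 := by
      have e : Qᴴ * tensorFamily (Function.update (fun i => (1 : Op (B i))) k (P k)) * Q =
          tensorUpdate (fun i => (1 : Op (B i))) k ((1 - Θ k)ᴴ * P k * (1 - Θ k)) := by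
        rw [tensorUpdate_apply, tensorFamily_conjTranspose, tensorFamily_mul, tensorFamily_mul]
        congr 1; funext i
        rcases eq_or_ne i k with rfl | hi
        · simp
        · simp [Function.update_of_ne hi]
      -- Both sides are now images under the linear map `tensorUpdate`, so their difference is a
      -- product operator with a single nontrivial factor.
      have e₁ : t • (1 : Op (∀ i, B i)) =
          tensorUpdate (fun i => (1 : Op (B i))) k (t • 1) := by
        rw [map_smul, tensorUpdate_apply, Function.update_eq_self k (fun i => (1 : Op (B i))),
          tensorFamily_one]
      rw [e, e₁, ← sub_nonneg, ← map_sub]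
      refine tensorFamily_nonneg fun i => ?_
      rcases eq_or_ne i k with rfl | hi
      · simpa using sub_nonneg.2 (conj_one_sub_thresholdImpl_le ht (hP _))
      · rw [Function.update_of_ne hi]; exact zero_le_one
    rw [hR, Matrix.conjTranspose_mul]
    calc (T j)ᴴ * Qᴴ * E * (Q * T j) = (T j)ᴴ * (Qᴴ * E * Q) * T j := by
          simp only [Matrix.mul_assoc]
      _ ≤ (T j)ᴴ * (t • 1) * T j := conj_le_conj ((conj_le_conj (hE k) Q).trans hQ) _
      _ = t • T j := by rw [hTH, Matrix.mul_smul, Matrix.mul_one, Matrix.smul_mul, hTT]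
      _ ≤ t • 1 := real_smul_mono (hT₁ j) ht
  calc E = (∑ j ∈ Finset.range (q + 1), R j)ᴴ * E * (∑ j ∈ Finset.range (q + 1), R j) := by
        simp [hsum]
    _ ≤ ((Finset.range (q + 1)).card : ℝ) • ∑ j ∈ Finset.range (q + 1), (R j)ᴴ * E * R j :=
        sum_conj_le _ hE₀ R
    _ ≤ ((q : ℝ) + 1) • (tensorFamily Θ + ((q : ℝ) * t) • (1 : Op (∀ i, B i))) := by
        rw [Finset.card_range, Nat.cast_succ]
        refine real_smul_mono ?_ (by positivity)
        rw [Finset.sum_range_succ, add_comm]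
        refine add_le_add hRq ((Finset.sum_le_sum hRj).trans_eq ?_)
        rw [Finset.sum_const, Finset.card_range, ← Nat.cast_smul_eq_nsmul ℝ, smul_smul]

end Registers

/-! ### Unitarity of circuits -/

section Circuits

/-- The Hadamard matrix. -/
def hadamard : Op Bool := Matrix.of fun x y => (if x && y then -1 else 1) / (Real.sqrt 2 : ℂ)

theorem hadamard_conjTranspose_mul_self : hadamardᴴ * hadamard = 1 := by
  have h : (Real.sqrt 2 : ℂ) * (Real.sqrt 2 : ℂ) = 2 := by
    rw [← Complex.ofReal_mul, Real.mul_self_sqrt (by norm_num)]; norm_num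
  have h' : (Real.sqrt 2 : ℂ)⁻¹ * (Real.sqrt 2 : ℂ)⁻¹ = 1 / 2 := by
    rw [← mul_inv, h, one_div]
  ext x y
  cases x <;> cases y <;>
    simp [Matrix.mul_apply, hadamard, Complex.conj_ofReal, div_eq_mul_inv] <;>
    linear_combination 2 * h'

/-- In product form, unitarity of the gate reduces to that of a 2 × 2 matrix. -/
theorem Gate.mat_H {n i : ℕ} (hi : i < n) :
    (Gate.H i).mat n =
      tensorFamily (Function.update (fun _ : Fin n => (1 : Op Bool)) ⟨i, hi⟩ hadamard) := by
  ext x y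
  rw [tensorFamily_update_apply]
  simp only [Gate.mat, dif_pos hi, Matrix.of_apply, hadamard, Matrix.one_apply]
  rw [Finset.prod_ite_zero]
  simp

theorem Gate.conjTranspose_mul_self (n : ℕ) (g : Gate) : (g.mat n)ᴴ * g.mat n = 1 := by
  cases g with
  | H i =>
    by_cases hi : i < n
    · rw [Gate.mat_H hi, tensorFamily_conjTranspose, tensorFamily_mul, ← tensorFamily_one]
      congr 1; funext k
      rcases eq_or_ne k ⟨i, hi⟩ with rfl | hk
      · simpa using hadamard_conjTranspose_mul_self
      · simp [Function.update_of_ne hk]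
    · simp [Gate.mat, hi]
  | T i =>
    by_cases hi : i < n
    · simp only [Gate.mat, dif_pos hi, Matrix.diagonal_conjTranspose, Matrix.diagonal_mul_diagonal]
      rw [← Matrix.diagonal_one]
      congr 1; funext x
      simp only [Pi.star_apply]
      split_ifs
      · rw [Complex.star_def, ← Complex.exp_conj, ← Complex.exp_add]
        have h4 : (starRingEnd ℂ) 4 = 4 := Complex.conj_ofNat 4
        simp [Complex.conj_ofReal, h4, neg_div]
      · simp
    · simp [Gate.mat, hi]
  | CNOT i j =>
    by_cases h : i < n ∧ j < n ∧ i ≠ j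
    · simp only [Gate.mat, dif_pos h]
      set σ : Bits n → Bits n := fun y =>
        Function.update y ⟨j, h.2.1⟩ (xor (y ⟨j, h.2.1⟩) (y ⟨i, h.1⟩)) with hσ
      have hij : (⟨i, h.1⟩ : Fin n) ≠ ⟨j, h.2.1⟩ := fun e => h.2.2 (Fin.mk.inj e)
      have hinv : Function.Involutive σ := fun y => by
        simp [hσ, Function.update_of_ne hij]
      ext x y
      rw [Matrix.mul_apply]
      simp only [Matrix.conjTranspose_apply, Matrix.of_apply]
      -- The gate permutes the basis by `σ`, so column `x` has its only nonzero entry in row `σ x`.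
      rw [Finset.sum_eq_single (σ x)]
      · simp only [hσ, if_true, star_one, one_mul, Matrix.one_apply]
        exact if_congr hinv.injective.eq_iff rfl rfl
      · intro z _ hz
        rw [if_neg hz]; simp
      · simp
    · simp [Gate.mat, h]

theorem circMat_conjTranspose_mul_self (n : ℕ) (gs : List Gate) :
    (circMat n gs)ᴴ * circMat n gs = 1 := by
  -- The fold carries an accumulator, so the induction needs an arbitrary isometric starting matrix.
  have key : ∀ (gs : List Gate) (U : Op (Bits n)), Uᴴ * U = 1 →
      (gs.foldl (fun U g => g.mat n * U) U)ᴴ * gs.foldl (fun U g => g.mat n * U) U = 1 := by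
    intro gs
    induction gs with
    | nil => intro U hU; simpa using hU
    | cons g gs ih =>
      intro U hU
      refine ih _ ?_
      rw [Matrix.conjTranspose_mul, Matrix.mul_assoc, ← Matrix.mul_assoc _ _ U,
        Gate.conjTranspose_mul_self, Matrix.one_mul, hU]
  exact key gs 1 (by simp)

end Circuits

/-! ### Positivity and trace of states -/

section States

theorem submatrix_nonneg {ι κ : Type} [Fintype ι] [Fintype κ] {A : Op ι} (hA : 0 ≤ A) (f : κ → ι) :
    0 ≤ A.submatrix f f :=
  Matrix.nonneg_iff_posSemidef.2 ((Matrix.nonneg_iff_posSemidef.1 hA).submatrix f)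

theorem zeroState_nonneg (n : ℕ) : 0 ≤ zeroState n := by
  have : zeroState n = Matrix.diagonal (Pi.single (fun _ => false) 1) := by
    rw [zeroState, Matrix.diagonal_single]
  rw [this, Matrix.nonneg_iff_posSemidef, Matrix.posSemidef_diagonal_iff]
  intro x
  rcases eq_or_ne x (fun _ => false) with rfl | h
  · simp
  · simp [Pi.single_eq_of_ne h]

theorem trace_zeroState (n : ℕ) : (zeroState n).trace = 1 := by
  simp [zeroState]

theorem tensor_nonneg {m n : ℕ} {ρ : Op (Bits m)} {σ : Op (Bits n)} (hρ : 0 ≤ ρ) (hσ : 0 ≤ σ) :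
    0 ≤ tensor ρ σ :=
  submatrix_nonneg (Matrix.nonneg_iff_posSemidef.2
    ((Matrix.nonneg_iff_posSemidef.1 hρ).kronecker (Matrix.nonneg_iff_posSemidef.1 hσ))) _

theorem trace_reindex {ι κ : Type} [Fintype ι] [Fintype κ] (A : Op ι) (e : ι ≃ κ) :
    (A.reindex e e).trace = A.trace := by
  simp only [Matrix.trace, Matrix.diag, Matrix.reindex_apply, Matrix.submatrix_apply]
  exact Equiv.sum_comp e.symm fun i => A i i

theorem trace_tensor {m n : ℕ} (ρ : Op (Bits m)) (σ : Op (Bits n)) :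
    (tensor ρ σ).trace = ρ.trace * σ.trace := by
  rw [tensor, trace_reindex, Matrix.trace_kronecker]

theorem tensorPow_nonneg {k : ℕ} {σ : Op (Bits k)} (hσ : 0 ≤ σ) (q : ℕ) : 0 ≤ tensorPow σ q := by
  induction q with
  | zero => exact zeroState_nonneg _
  | succ q ih => exact tensor_nonneg ih hσ

theorem trace_tensorPow {k : ℕ} {σ : Op (Bits k)} (hσ : σ.trace = 1) (q : ℕ) :
    (tensorPow σ q).trace = 1 := by
  induction q with
  | zero => exact trace_zeroState _
  | succ q ih =>
    refine (trace_tensor (tensorPow σ q) σ).trans ?_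
    rw [ih, hσ, one_mul]

theorem ptraceRight_nonneg {m n : ℕ} {ρ : Op (Bits (m + n))} (hρ : 0 ≤ ρ) : 0 ≤ ptraceRight ρ :=
  Finset.sum_nonneg fun _ _ => submatrix_nonneg hρ _

theorem sum_append {m n : ℕ} {V : Type} [AddCommMonoid V] (f : Bits (m + n) → V) :
    ∑ x : Bits m, ∑ z : Bits n, f (Fin.append x z) = ∑ w, f w := by
  rw [← Fintype.sum_prod_type']
  exact Equiv.sum_comp (Fin.appendEquiv m n) f

theorem trace_ptraceRight {m n : ℕ} (ρ : Op (Bits (m + n))) : (ptraceRight ρ).trace = ρ.trace := by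
  rw [ptraceRight, Matrix.trace_sum]
  exact Finset.sum_comm.trans (sum_append fun w => ρ w w)

theorem postMeasure_nonneg {m n : ℕ} {ρ : Op (Bits (m + n))} (hρ : 0 ≤ ρ) (y : Bits m) :
    0 ≤ postMeasure y ρ :=
  submatrix_nonneg hρ _

theorem sum_trace_postMeasure {m n : ℕ} (ρ : Op (Bits (m + n))) :
    ∑ y, (postMeasure y ρ).trace = ρ.trace :=
  sum_append fun w => ρ w w

variable {α : Type} [Code α] (A : QAlg α) (a : α) (k : ℕ)

theorem QAlg.run_nonneg {j : ℕ} {ρ : Op (Bits j)} (hρ : 0 ≤ ρ) : 0 ≤ A.run a k ρ := by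
  refine ptraceRight_nonneg ?_
  have := conj_le_conj (tensor_nonneg (zeroState_nonneg k)
    (tensor_nonneg hρ (zeroState_nonneg (A.anc a)))) (circMat (k + (j + A.anc a)) (A.circ a))ᴴ
  simpa using this

theorem QAlg.trace_run {j : ℕ} (ρ : Op (Bits j)) : (A.run a k ρ).trace = ρ.trace := by
  rw [QAlg.run]
  rw [trace_ptraceRight, Matrix.trace_mul_comm, ← Matrix.mul_assoc,
    circMat_conjTranspose_mul_self, Matrix.one_mul, trace_tensor, trace_tensor, trace_zeroState,
    trace_zeroState, one_mul, mul_one]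

theorem QAlg.prob_nonneg {k : ℕ} (x : Bits k) : 0 ≤ A.prob a x := by
  have := (Matrix.nonneg_iff_posSemidef.1 (A.run_nonneg a k (zeroState_nonneg 0))).diag_nonneg
    (i := x)
  exact (Complex.le_def.1 this).1

theorem QAlg.sum_prob : ∑ x : Bits k, A.prob a x = 1 := by
  have := congrArg Complex.re ((A.trace_run a k (zeroState 0)).trans (trace_zeroState 0))
  simpa [Matrix.trace, QAlg.prob] using this

end States

/-! ### Effects of decryptors -/

section Effects

variable (s : ℕ) (gs : List Gate) {c k : ℕ} (ct : Bits c) (m : Bits k)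

theorem decEffect_nonneg : 0 ≤ decEffect s gs ct m := by
  have h : (0 : Op (Bits (c + s))) ≤
      Matrix.diagonal (fun z => if readBits k z = m then (1 : ℂ) else 0) := by
    rw [Matrix.nonneg_iff_posSemidef, Matrix.posSemidef_diagonal_iff]
    intro z
    split_ifs <;> simp
  simpa [decEffect] using
    conj_le_conj h ((circMat (c + s) gs).submatrix id (fun x => Fin.append ct x))

theorem decEffect_le_one : decEffect s gs ct m ≤ 1 := by
  have h : Matrix.diagonal (fun z => if readBits k z = m then (1 : ℂ) else 0) ≤
      (1 : Op (Bits (c + s))) := by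
    rw [Matrix.le_iff, ← Matrix.diagonal_one, Matrix.diagonal_sub, Matrix.posSemidef_diagonal_iff]
    intro z
    split_ifs <;> simp
  refine (conj_le_conj h
    ((circMat (c + s) gs).submatrix id (fun x => Fin.append ct x))).trans_eq ?_
  rw [Matrix.mul_one]
  -- The compressed matrix is the block of `Uᴴ * U = 1` indexed by strings that begin with `ct`.
  ext x y
  refine (congrFun₂ (circMat_conjTranspose_mul_self (c + s) gs)
    (Fin.append ct x) (Fin.append ct y)).trans ?_
  rw [Matrix.one_apply, Matrix.one_apply]
  refine if_congr ⟨fun h => ?_, fun h => by rw [h]⟩ rfl rfl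
  exact (Prod.mk.inj ((Fin.appendEquiv c s).injective (a₁ := (ct, x)) (a₂ := (ct, y)) h)).2

end Effects

/-! ### Output length of polynomial-time machines -/

section PolyTime

open Turing

/-- The constant counts the pushes along the longest branch of the statement, so it does not depend
on the configuration. -/
theorem stepAux_length_le {K : Type} [DecidableEq K] {Γ : K → Type} {Λ σ : Type}
    (s : TM2.Stmt Γ Λ σ) :
    ∃ c : ℕ, ∀ v S k, ((TM2.stepAux s v S).stk k).length ≤ (S k).length + c := by
  induction s with
  | push k' f s ih =>
    obtain ⟨c, hc⟩ := ih
    refine ⟨c + 1, fun v S k => (hc _ _ k).trans ?_⟩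
    rcases eq_or_ne k k' with rfl | h
    · simp +arith
    · simp +arith [Function.update_of_ne h]
  | peek k' f s ih =>
    obtain ⟨c, hc⟩ := ih
    exact ⟨c, fun v S k => hc _ _ k⟩
  | pop k' f s ih =>
    obtain ⟨c, hc⟩ := ih
    refine ⟨c, fun v S k => (hc _ _ k).trans ?_⟩
    rcases eq_or_ne k k' with rfl | h
    · simp
    · simp [Function.update_of_ne h]
  | load a s ih =>
    obtain ⟨c, hc⟩ := ih
    exact ⟨c, fun v S k => hc _ _ k⟩
  | branch f s₁ s₂ ih₁ ih₂ =>
    obtain ⟨c₁, hc₁⟩ := ih₁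
    obtain ⟨c₂, hc₂⟩ := ih₂
    refine ⟨max c₁ c₂, fun v S k => ?_⟩
    rw [TM2.stepAux]
    cases f v
    · exact (hc₂ v S k).trans (by gcongr; exact le_max_right _ _)
    · exact (hc₁ v S k).trans (by gcongr; exact le_max_left _ _)
  | goto f => exact ⟨0, fun v S k => le_rfl⟩
  | halt => exact ⟨0, fun v S k => le_rfl⟩

/-- A machine pushes a bounded number of symbols at each step. -/
theorem iterate_step_length_le (tm : FinTM2) :
    ∃ c : ℕ, ∀ (m : ℕ) (a b : tm.Cfg), (flip bind tm.step)^[m] (some a) = some b →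
      ∀ k, (b.stk k).length ≤ (a.stk k).length + m * c := by
  choose c hc using fun l => stepAux_length_le (tm.m l)
  have := tm.ΛFin
  refine ⟨∑ l, c l, fun m => ?_⟩
  induction m with
  | zero =>
    rintro a b h k
    cases h
    simp
  | succ m ih =>
    intro a b h k
    rw [Function.iterate_succ_apply'] at h
    obtain ⟨d, hd, hb⟩ := Option.bind_eq_some_iff.1 h
    have := ih a d hd k
    obtain ⟨_ | l, v, S⟩ := d
    · simp [TM2.step] at hb
    · have hb : TM2.stepAux (tm.m l) v S = b := Option.some.inj hb
      have h₁ : c l ≤ ∑ l, c l := Finset.single_le_sum (fun _ _ => Nat.zero_le _)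
        (Finset.mem_univ l)
      have h₂ := hc l v S k
      rw [hb] at h₂
      dsimp only at this
      rw [Nat.succ_mul]
      omega

theorem PolyTime.length_le {α β : Type} [Code α] [Code β] {f : α → β} (hf : PolyTime f) :
    ∃ p : Polynomial ℕ, ∀ a, (Code.code (f a)).length ≤ p.eval (Code.code a).length := by
  obtain ⟨M⟩ := hf
  obtain ⟨c, hc⟩ := iterate_step_length_le M.tm
  refine ⟨Polynomial.X + M.time * Polynomial.C c, fun a => ?_⟩
  have h := M.outputsFun a
  have h₁ := hc _ _ _ h.evals_in_steps M.tm.k₁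
  have h₂ := h.steps_le_m
  have e₁ : ((haltList M.tm (List.map M.outputAlphabet.invFun (Code.code (f a)))).stk
      M.tm.k₁).length = (Code.code (f a)).length := by
    simp [haltList]
  -- The output stack starts empty unless it is also the input stack; this accounts for the summand
  -- `X` in the bound.
  have e₂ : ((initList M.tm (List.map M.inputAlphabet.invFun (Code.code a))).stk
      M.tm.k₁).length ≤ (Code.code a).length := by
    unfold initList
    dsimp only
    split_ifs with h
    · have : ∀ (k : M.tm.K) (h : k = M.tm.k₀) (s : List (M.tm.Γ M.tm.k₀)),
          ((by rw [h]; exact s : List (M.tm.Γ k))).length = s.length := by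
        rintro k rfl s; rfl
      exact (this _ h _).trans (List.length_map _) |>.le
    · simp
  rw [e₁] at h₁
  simp only [Polynomial.eval_add, Polynomial.eval_X, Polynomial.eval_mul, Polynomial.eval_C]
  exact h₁.trans (add_le_add e₂ (Nat.mul_le_mul_right _ h₂))

theorem length_codeNat (n : ℕ) : (Code.code n).length = n + 1 := by
  change (codeNat n).length = n + 1
  induction n with
  | zero => rfl
  | succ n ih => simp [codeNat, ih]

theorem length_code_prod {α β : Type} [Code α] [Code β] (x : α × β) :
    (Code.code x).length = (Code.code x.1).length + (Code.code x.2).length :=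
  List.length_append

theorem length_code_bits (l : List Bool) : (Code.code l).length = 2 * l.length + 1 := by
  change (codeList l).length = _
  induction l with
  | nil => rfl
  | cons b l ih =>
    have : (Code.code b).length = 1 := rfl
    simp [codeList, ih, this]; omega

theorem eval_mono_nat (p : Polynomial ℕ) : Monotone fun n : ℕ => p.eval n := by
  intro m n h
  simp only [Polynomial.eval_eq_sum, Polynomial.sum]
  gcongr

/-- Numbers are coded in unary, so a bound on the code length bounds the value. The free `N` allows
such bounds to be composed. -/
theorem PolyTime.le_eval {α : Type} [Code α] {f : α → ℕ} (hf : PolyTime f) :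
    ∃ p : Polynomial ℕ, ∀ a N, (Code.code a).length ≤ N → f a ≤ p.eval N := by
  obtain ⟨p, hp⟩ := hf.length_le
  refine ⟨p, fun a N h => ?_⟩
  have : (Code.code (f a)).length ≤ p.eval N := (hp a).trans (eval_mono_nat p h)
  rw [length_codeNat] at this
  omega

/-- The number of keys requested in a game is bounded by a polynomial in the security parameter. -/
theorem QPTAdversary.numKeys_le (A : QPTAdversary) (S : SDEAlgorithms) :
    ∃ p : Polynomial ℕ, ∀ n (pk : Bits (S.pkLen n)) (y : Bits (A.out₁ (n, List.ofFn pk))),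
      A.numKeys (n, List.ofFn pk, List.ofFn y) ≤ p.eval n := by
  obtain ⟨p₁, h₁⟩ := S.pkLen_poly.le_eval
  obtain ⟨p₂, h₂⟩ := A.out₁_poly.le_eval
  obtain ⟨p₃, h₃⟩ := A.numKeys_poly.le_eval
  -- The arguments follow code lengths: `n + 1` for the number `n`, and `2 * l + 1` for a string of
  -- `l` bits.
  let r₁ : Polynomial ℕ := p₁.comp (Polynomial.X + 1)
  let r₂ : Polynomial ℕ := p₂.comp (Polynomial.X + 1 + (2 * r₁ + 1))
  refine ⟨p₃.comp (Polynomial.X + 1 + (2 * r₁ + 1 + (2 * r₂ + 1))), fun n pk y => ?_⟩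
  have e₁ : S.pkLen n ≤ r₁.eval n := by
    simpa [r₁] using h₁ n (n + 1) (length_codeNat n).le
  have e₂ : A.out₁ (n, List.ofFn pk) ≤ r₂.eval n := by
    simpa [r₂] using h₂ (n, List.ofFn pk) (n + 1 + (2 * r₁.eval n + 1)) (by
      rw [length_code_prod, length_codeNat, length_code_bits, List.length_ofFn]; omega)
  simpa using h₃ (n, List.ofFn pk, List.ofFn y)
    (n + 1 + (2 * r₁.eval n + 1 + (2 * r₂.eval n + 1))) (by
      rw [length_code_prod, length_code_prod, length_codeNat, length_code_bits, length_code_bits,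
        List.length_ofFn, List.length_ofFn]
      dsimp only
      omega)

end PolyTime

/-! ### Averages over the challenge and a single set of decryptors -/

namespace SDEAlgorithms

variable (S : SDEAlgorithms) (n : ℕ)

theorem setupProb_nonneg (pk : Bits (S.pkLen n)) (msk : Bits (S.mskLen n)) :
    0 ≤ S.setupProb n pk msk :=
  QAlg.prob_nonneg _ _ _

theorem sum_setupProb : ∑ pk, ∑ msk, S.setupProb n pk msk = 1 :=
  (sum_append fun x => S.setup.prob n x).trans (QAlg.sum_prob _ _ _)

theorem keyState_nonneg (msk : Bits (S.mskLen n)) : 0 ≤ S.keyState n msk :=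
  QAlg.run_nonneg _ _ _ (zeroState_nonneg 0)

theorem trace_keyState (msk : Bits (S.mskLen n)) : (S.keyState n msk).trace = 1 :=
  (QAlg.trace_run _ _ _ _).trans (trace_zeroState 0)

variable (pk : Bits (S.pkLen n))

/-- Used twice: with `tensorUpdate`, to recognise the marginal of the average as `searchPOVM`, and
with `traceRe`, to write the winning probability as one trace. -/
theorem map_challengeAvg {V W : Type} [AddCommGroup V] [Module ℝ V] [AddCommGroup W] [Module ℝ W]
    (L : V →ₗ[ℝ] W) (f : Bits (S.msgLen n) → Bits (S.ctLen n) → V) :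
    L (S.challengeAvg n pk f) = S.challengeAvg n pk fun m ct => L (f m ct) := by
  simp only [challengeAvg, map_smul, map_sum]

theorem challengeAvg_const {V : Type} [AddCommGroup V] [Module ℝ V] (v : V) :
    S.challengeAvg n pk (fun _ _ => v) = v := by
  have h : ∀ m, ∑ ct, S.encProb n pk m ct = 1 := fun m => QAlg.sum_prob _ _ _
  have hc : ((S.msgSpace n).card : ℝ) ≠ 0 :=
    Nat.cast_ne_zero.2 (Finset.card_pos.2 (S.msgSpace_nonempty n)).ne'
  simp only [challengeAvg, ← Finset.sum_smul, h, one_smul, Finset.sum_const]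
  rw [← Nat.cast_smul_eq_nsmul ℝ, smul_smul, one_div, inv_mul_cancel₀ hc, one_smul]

theorem challengeAvg_mono {ι : Type} [Fintype ι]
    {f g : Bits (S.msgLen n) → Bits (S.ctLen n) → Op ι} (h : ∀ m ct, f m ct ≤ g m ct) :
    S.challengeAvg n pk f ≤ S.challengeAvg n pk g :=
  real_smul_mono (Finset.sum_le_sum fun m _ => Finset.sum_le_sum fun ct _ =>
    real_smul_mono (h m ct) (QAlg.prob_nonneg _ _ _)) (by positivity)

theorem challengeAvg_nonneg {ι : Type} [Fintype ι]
    {f : Bits (S.msgLen n) → Bits (S.ctLen n) → Op ι} (h : ∀ m ct, 0 ≤ f m ct) :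
    0 ≤ S.challengeAvg n pk f := by
  simpa [challengeAvg_const] using S.challengeAvg_mono n pk h

/-- The functional `A ↦ Re Tr[A ρ]`. -/
def traceRe {ι : Type} [Fintype ι] (ρ : Op ι) : Op ι →ₗ[ℝ] ℝ where
  toFun A := (A * ρ).trace.re
  map_add' A B := by simp [Matrix.add_mul]
  map_smul' c A := by simp [Matrix.trace_smul]

/-- Winning the identical-challenge game is controlled by passing the search tests. -/
theorem identicalChallengeWin_le {γ : ℝ} (hγ : 0 ≤ γ) (D : Decryptors) (hD : 0 ≤ D.state) :
    S.identicalChallengeWin n pk D ≤ ((D.num : ℝ) + 1) * (S.strongSearchWin n pk γ D +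
      D.num * (1 / ((S.msgSpace n).card : ℝ) + γ) * D.state.trace.re) := by
  have h₀ := fun m ct i => decEffect_nonneg (D.size i) (D.circ i) (k := S.msgLen n)
    (c := S.ctLen n) ct m
  have h₁ := fun m ct i => decEffect_le_one (D.size i) (D.circ i) (k := S.msgLen n)
    (c := S.ctLen n) ct m
  have key := le_thresholdImpl_of_le_marginals
    (E := S.challengeAvg n pk fun m ct =>
      tensorFamily fun i => decEffect (D.size i) (D.circ i) ct m)
    (S.challengeAvg_nonneg n pk fun m ct => tensorFamily_nonneg (h₀ m ct))
    ((S.challengeAvg_mono n pk fun m ct => tensorFamily_le_one (h₀ m ct) (h₁ m ct)).trans_eq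
      (S.challengeAvg_const n pk 1))
    (P := fun i => S.searchPOVM n pk (D.size i) (D.circ i))
    (fun i => (Matrix.nonneg_iff_posSemidef.1
      (S.challengeAvg_nonneg n pk fun m ct => h₀ m ct i)).isHermitian)
    (t := 1 / ((S.msgSpace n).card : ℝ) + γ) (by positivity)
    (fun k => (S.challengeAvg_mono n pk fun m ct =>
      tensorFamily_le_update_one (h₀ m ct) (h₁ m ct) k).trans_eq
        (S.map_challengeAvg n pk (tensorUpdate _ k) _).symm)
  have h := trace_mul_mono key hD
  rw [show S.identicalChallengeWin n pk D = _ from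
    (S.map_challengeAvg n pk (traceRe D.state) _).symm]
  refine h.trans_eq ?_
  rw [Matrix.smul_mul, Matrix.add_mul, Matrix.smul_mul, Matrix.one_mul, Matrix.trace_smul,
    Matrix.trace_add, Matrix.trace_smul, Complex.smul_re, Complex.add_re, Complex.smul_re,
    smul_eq_mul, smul_eq_mul]
  rfl

theorem strongSearchWin_nonneg {γ : ℝ} {D : Decryptors} (hD : 0 ≤ D.state) :
    0 ≤ S.strongSearchWin n pk γ D :=
  trace_mul_nonneg (tensorFamily_nonneg fun _ => thresholdImpl_nonneg _ _) hD

end SDEAlgorithms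

/-! ### Averaging over the adversary's run -/

namespace QPTAdversary

variable (A : QPTAdversary) (S : SDEAlgorithms) (n : ℕ) (pk : Bits (S.pkLen n))
  (msk : Bits (S.mskLen n))

theorem memory_nonneg (a : ℕ × List Bool) (y : Bits (A.out₁ a)) : 0 ≤ A.memory a y :=
  postMeasure_nonneg (QAlg.run_nonneg _ _ _ (zeroState_nonneg 0)) y

theorem sum_trace_memory (a : ℕ × List Bool) : ∑ y, (A.memory a y).trace = 1 :=
  (sum_trace_postMeasure _).trans ((QAlg.trace_run _ _ _ _).trans (trace_zeroState 0))

theorem output_state_nonneg (y : Bits (A.out₁ (n, List.ofFn pk)))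
    (z : Bits (A.out₂ (n, List.ofFn pk, List.ofFn y))) :
    0 ≤ (A.output S n pk msk y z).state :=
  submatrix_nonneg (postMeasure_nonneg (QAlg.run_nonneg _ _ _ (tensor_nonneg
    (A.memory_nonneg _ y) (tensorPow_nonneg (S.keyState_nonneg n msk) _))) z) _

theorem sum_trace_output : ∑ y, ∑ z, (A.output S n pk msk y z).state.trace = 1 := by
  refine (Finset.sum_congr rfl fun y _ => ?_).trans (A.sum_trace_memory (n, List.ofFn pk))
  refine (Finset.sum_congr rfl fun z _ => trace_reindex _ _).trans ?_
  refine (sum_trace_postMeasure _).trans ((QAlg.trace_run _ _ _ _).trans ?_)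
  rw [trace_tensor, trace_tensorPow (S.trace_keyState n msk), mul_one]

theorem advantage_mono {w w' : Bits (S.pkLen n) → Decryptors → ℝ}
    (h : ∀ pk msk y z, w pk (A.output S n pk msk y z) ≤ w' pk (A.output S n pk msk y z)) :
    A.advantage S n w ≤ A.advantage S n w' :=
  Finset.sum_le_sum fun pk _ => Finset.sum_le_sum fun msk _ =>
    mul_le_mul_of_nonneg_left (Finset.sum_le_sum fun y _ => Finset.sum_le_sum fun z _ =>
      h pk msk y z) (S.setupProb_nonneg n pk msk)

theorem advantage_add (w w' : Bits (S.pkLen n) → Decryptors → ℝ) :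
    A.advantage S n (fun pk D => w pk D + w' pk D) = A.advantage S n w + A.advantage S n w' := by
  simp only [advantage, Finset.sum_add_distrib, mul_add]

theorem advantage_const_mul (c : ℝ) (w : Bits (S.pkLen n) → Decryptors → ℝ) :
    A.advantage S n (fun pk D => c * w pk D) = c * A.advantage S n w := by
  simp only [advantage, ← Finset.mul_sum, mul_left_comm _ c]

/-- The unnormalised output states have total weight one, so a multiple of the identity in the
operator bound becomes a plain constant. -/
theorem advantage_trace : A.advantage S n (fun _ D => D.state.trace.re) = 1 := by
  have h : ∀ pk msk, ∑ y, ∑ z, (A.output S n pk msk y z).state.trace.re = 1 := fun pk msk => by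
    simpa using congrArg Complex.re (A.sum_trace_output S n pk msk)
  simp only [advantage, h, mul_one]
  exact S.sum_setupProb n

/-- The advantages of one adversary in the identical-challenge and strong-search games. -/
theorem advantage_identicalChallenge_le {γ : ℝ} (hγ : 0 ≤ γ) {N : ℕ}
    (hN : ∀ (pk : Bits (S.pkLen n)) (y : Bits (A.out₁ (n, List.ofFn pk))),
      A.numKeys (n, List.ofFn pk, List.ofFn y) + 2 ≤ N) :
    A.advantage S n (fun pk D => S.identicalChallengeWin n pk D) ≤
      N * A.advantage S n (fun pk D => S.strongSearchWin n pk γ D) +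
        N ^ 2 * (1 / ((S.msgSpace n).card : ℝ) + γ) := by
  set t : ℝ := 1 / ((S.msgSpace n).card : ℝ) + γ with ht
  have ht₀ : 0 ≤ t := by positivity
  have h := A.advantage_mono S n (w := fun pk D => S.identicalChallengeWin n pk D)
    (w' := fun pk D => N * S.strongSearchWin n pk γ D + (N ^ 2 * t) * D.state.trace.re) (by
      intro pk msk y z
      set D := A.output S n pk msk y z with hDdef
      have hD : 0 ≤ D.state := A.output_state_nonneg S n pk msk y z
      refine (S.identicalChallengeWin_le n pk hγ D hD).trans ?_
      -- There is one decryptor more than there are keys and one branch more than there are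
      -- decryptors, hence the `+ 2` in `hN`.
      have h₁ : (D.num : ℝ) + 1 ≤ N := by exact_mod_cast hN pk y
      have h₂ := S.strongSearchWin_nonneg n pk (γ := γ) hD
      have h₃ := trace_re_nonneg hD
      have h₄ : (D.num : ℝ) ≤ N := by linarith
      calc ((D.num : ℝ) + 1) * (S.strongSearchWin n pk γ D + D.num * t * D.state.trace.re)
          ≤ N * (S.strongSearchWin n pk γ D + N * t * D.state.trace.re) := by gcongr
        _ = _ := by ring)
  rw [advantage_add, advantage_const_mul, advantage_const_mul, advantage_trace, mul_one] at h
  exact h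

end QPTAdversary

/-! ### Choice of the parameter and conclusion -/

theorem Negligible.polynomial_mul {f : ℕ → ℝ} (hf : Negligible f) (p : Polynomial ℕ) :
    Negligible fun n => ((p.eval n : ℕ) : ℝ) * f n := by
  have := Asymptotics.SuperpolynomialDecay.polynomial_mul hf (p.map (Nat.castRingHom ℝ))
  refine this.congr fun n => ?_
  simp

end QCrypt

end

theorem theorem8p5 (S : QCrypt.SDEScheme)
    (hM : QCrypt.Negligible fun n => 1 / ((S.msgSpace n).card : ℝ))
    (hS : S.StrongSearchSecure) : S.IdenticalChallengeSecure := by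
  rintro γ ⟨hγ, p, hp⟩ A
  obtain ⟨r, hr⟩ := A.numKeys_le S.toSDEAlgorithms
  let N : Polynomial ℕ := r + 2
  have hN : ∀ n : ℕ, N.eval n = r.eval n + 2 := fun n => by simp [N]
  have hN₁ : ∀ n : ℕ, (1 : ℝ) ≤ (N.eval n : ℕ) := fun n => by
    rw [hN]; push_cast; linarith [(Nat.cast_nonneg (r.eval n) : (0 : ℝ) ≤ _)]
  -- Chosen so that the loss `N²` turns `γ'` back into exactly `γ`.
  let γ' : ℕ → ℝ := fun n => γ n / ((N.eval n : ℕ) : ℝ) ^ 2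
  have hγ' : QCrypt.InversePolynomial γ' := by
    refine ⟨fun n => ⟨div_pos (hγ n).1 (by have := hN₁ n; positivity), ?_⟩, p * N ^ 2, fun n => ?_⟩
    · exact (div_le_self (hγ n).1.le (one_le_pow₀ (hN₁ n))).trans (hγ n).2
    · rw [Polynomial.eval_mul, Polynomial.eval_pow]
      refine ⟨Nat.mul_pos (hp n).1 (by rw [hN]; positivity), ?_⟩
      push_cast
      rw [← div_div]
      exact div_le_div_of_nonneg_right (hp n).2 (by positivity)
  refine ⟨_, ((hS γ' hγ' A).polynomial_mul N).add (hM.polynomial_mul (N ^ 2)), fun n => ?_⟩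
  have h := A.advantage_identicalChallenge_le S.toSDEAlgorithms n (hγ'.1 n).1.le (N := N.eval n)
    fun pk y => by rw [hN]; exact Nat.add_le_add_right (hr n pk y) 2
  refine h.trans ?_
  have e : ((N.eval n : ℕ) : ℝ) ^ 2 * γ' n = γ n :=
    mul_div_cancel₀ _ (by have := hN₁ n; positivity)
  -- The allowance `1/|𝓜|` in the goal is pure slack: the bound obtained is already `γ` plus the
  -- negligible terms.
  have hc : 0 ≤ 1 / ((S.msgSpace n).card : ℝ) := by positivity
  rw [mul_add, e]
  simp only [Pi.add_apply, Polynomial.eval_pow, Nat.cast_pow]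
  linarith
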